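/- For a positive integer $k$, let $\operatorname{RR}(x+y+kz=4w)$ denote the $2$-color Rado number of the equation $x+y+kz=4w$, i.e. the least positive integer $N$ such that every coloring of $\{1,2,\dots,N\}$ with two colors admits $x,y,z,w\in\{1,\dots,N\}$, not necessarily distinct and all of the same color, with $x+y+kz=4w$. Let $k\ge 6$ be an integer with $k\ne 16$. Then $\operatorname{RR}(x+y+kz=4w)$ exists. If $k=15$ it equals $24$, and if $k\neq 15$ it is given by $$ \operatorname{RR}(x+y+kz=4w)= \begin{cases} \frac{k^2+6k+16}{16} & \text{for } k\equiv 0 \pmod{16},\\ \frac{k^2+5k+10}{16} & \text{for } k\equiv 1,10 \pmod{16},\\ \frac{k^2+4k+4}{16} & \text{for } k\equiv 2 \pmod{16},\\ \frac{k^2+8k+7}{16} & \text{for } k\equiv 7 \pmod{16},\\ \frac{k^2+7k+8}{16} & \text{for } k\equiv 8 \pmod{16},\\ \frac{k^2+6k+9}{16} & \text{for } k\equiv 9 \pmod{16},\\ \frac{k^2+9k+20}{16} & \text{for } k\equiv 11 \pmod{16},\\ \frac{k^2+8k+16}{16} & \text{for } k\equiv 12 \pmod{16},\\ \frac{k^2+7k+12}{16}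 & \text{for } k\equiv 13 \pmod{16},\\ \frac{k^2+6k+8}{16} & \text{for } k\equiv 14 \pmod{16},\\ \frac{k^2+7k+22}{16} & \text{for } k\equiv 15 \pmod{16},\\ \frac{4k^2+30k+66}{64} & \text{for } k\equiv 3,35 \pmod{64},\\ \frac{4k^2+30k+34}{64} & \text{for } k\equiv 19,51 \pmod{64},\\ \frac{4k^2+26k+24}{64} & \text{for } k\equiv 4,36 \pmod{64},\\ \frac{4k^2+26k+56}{64} & \text{for } k\equiv 20,52 \pmod{64},\\ \frac{4k^2+22k+46}{64} & \text{for } k\equiv 5,37 \pmod{64},\\ \frac{4k^2+22k+78}{64} & \text{for } k\equiv 21,53 \pmod{64},\\ \frac{4k^2+18k+68}{64} & \text{for } k\equiv 6,38 \pmod{64},\\ \frac{4k^2+18k+36}{64} & \text{for } k\equiv 22,54 \pmod{64}. \end{cases} $$ -/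

import Mathlib

/-- An `r`-coloring of the integer interval `[1, n]`. -/
abbrev RadoColoring (r n : ℕ) : Type := Set.Icc (1 : ℕ) n → Fin r

/-- `x` is a monochromatic solution of the equation `E` in `m` variables with respect to the
coloring `χ` of `[1, n]`: the values (not necessarily distinct) lie in `[1, n]`, satisfy the
equation and all have the same color. -/
def IsMonochromaticSolution {r n m : ℕ} (E : (Fin m → ℕ) → Prop) (χ : RadoColoring r n)
    (x : Fin m → Set.Icc (1 : ℕ) n) : Prop :=
  E (fun i => (x i : ℕ)) ∧ ∀ i j, χ (x i) = χ (x j)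

/-- `N` is the `r`-color Rado number of the equation `E`: the least `n` such that every
`r`-coloring of `[1, n]` admits a monochromatic solution of `E`. -/
def IsRadoNumber {m : ℕ} (r : ℕ) (E : (Fin m → ℕ) → Prop) (N : ℕ) : Prop :=
  IsLeast {n : ℕ | ∀ χ : RadoColoring r n, ∃ x, IsMonochromaticSolution E χ x} N

/-- The equation `x + y + k z = 4 w` in the variables `(x, y, z, w) = (v 0, v 1, v 2, v 3)`. -/
def radoEquation (k : ℕ) (v : Fin 4 → ℕ) : Prop :=
  v 0 + v 1 + k * v 2 = 4 * v 3

/-! Call `true` red and `false` blue, and put a = ⌈(k+2)/4⌉, M = ⌈(k+2)a/4⌉. With [1, a-1] red, no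
red w below a completes a solution; with [a, M-1] blue, no blue w does. From M on red is used again,
and this survives as long as the possible values of kz fall strictly between consecutive multiples
of k (`solutionFree_three_intervals`). The first N where this breaks down is the Rado number; for k
≡ 15, 0, 1, 2 (mod 16), apart from k = 15, it is already M.

For the upper bound let 1 be red. Short propositional arguments make 2, ..., 6 red, and an induction
on multiples of k extends this to [1, 4m-2] (`SolutionFree.initial_red`), where m is about k/16;
this is all but at most four elements of [1, a-1]. Red x, y, z in this range force blue numbers near
a and 2a (`SolutionFree.blue_of_red`). These force N, and in most residue classes a number at or
next to M, to be red, and one last solution becomes entirely red. The argument needs m large enough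
for its auxiliary numbers to lie in [1, 4m-2]; the remaining k are settled by a verified
backtracking search. -/

/-- The coloring `c` has no monochromatic solution of `x + y + k z = 4 w` in `[1, N]`. -/
def SolutionFree (k N : ℕ) (c : ℕ → Bool) : Prop :=
  ∀ x y z w, 1 ≤ x → x ≤ N → 1 ≤ y → y ≤ N → 1 ≤ z → z ≤ N → 1 ≤ w → w ≤ N →
    x + y + k * z = 4 * w → ¬ (c x = c w ∧ c y = c w ∧ c z = c w)

theorem SolutionFree.mono {k N n : ℕ} {c : ℕ → Bool} (h : SolutionFree k N c) (hn : n ≤ N) :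
    SolutionFree k n c := fun x y z w hx hx' hy hy' hz hz' hw hw' =>
  h x y z w hx (hx'.trans hn) hy (hy'.trans hn) hz (hz'.trans hn) hw (hw'.trans hn)

theorem SolutionFree.not {k N : ℕ} {c : ℕ → Bool} (h : SolutionFree k N c) :
    SolutionFree k N (fun n => !c n) := fun x y z w hx hx' hy hy' hz hz' hw hw' e hc =>
  h x y z w hx hx' hy hy' hz hz' hw hw' e (by simpa using hc)

/-- Swapping the colors preserves solution-freeness, so 1 may be taken red. Restricting to a shorter
interval also preserves it, so one good coloring of [1, N-1] rules out every smaller n. -/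
theorem isRadoNumber_radoEquation {k N : ℕ} (hN : 1 ≤ N)
    (upper : ∀ c : ℕ → Bool, c 1 = true → ¬ SolutionFree k N c)
    (lower : ∃ c : ℕ → Bool, SolutionFree k (N - 1) c) :
    IsRadoNumber 2 (radoEquation k) N := by
  have upper' : ∀ c : ℕ → Bool, ¬ SolutionFree k N c := by
    intro c hc
    cases h : c 1
    · exact upper _ (by simp [h]) hc.not
    · exact upper c h hc
  constructor
  · intro χ
    by_contra hχ
    push Not at hχ
    apply upper' fun n => if h : n ∈ Set.Icc 1 N then decide (χ ⟨n, h⟩ = 0) else false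
    intro x y z w hx hx' hy hy' hz hz' hw hw' e hc
    have mx : x ∈ Set.Icc 1 N := ⟨hx, hx'⟩
    have my : y ∈ Set.Icc 1 N := ⟨hy, hy'⟩
    have mz : z ∈ Set.Icc 1 N := ⟨hz, hz'⟩
    have mw : w ∈ Set.Icc 1 N := ⟨hw, hw'⟩
    simp only [mx, my, mz, mw, dif_pos, decide_eq_decide] at hc
    have key : ∀ a b : Fin 2, (a = 0 ↔ b = 0) → a = b := by decide
    have h1 := key _ _ hc.1
    have h2 := key _ _ hc.2.1
    have h3 := key _ _ hc.2.2
    refine hχ ![⟨x, mx⟩, ⟨y, my⟩, ⟨z, mz⟩, ⟨w, mw⟩] ⟨by simpa [radoEquation] using e, ?_⟩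
    have h4 : ∀ i, χ ((![⟨x, mx⟩, ⟨y, my⟩, ⟨z, mz⟩, ⟨w, mw⟩] : Fin 4 → Set.Icc 1 N) i) =
        χ ⟨w, mw⟩ := by
      intro i
      fin_cases i
      · exact h1
      · exact h2
      · exact h3
      · rfl
    intro i j
    rw [h4 i, h4 j]
  · intro n hn
    by_contra hlt
    obtain ⟨c, hc⟩ := lower
    have hc' := hc.mono (n := n) (by omega)
    obtain ⟨x, e, hx⟩ := hn fun i => if c i then 0 else 1
    have key : ∀ a b : Bool, ((if a then 0 else 1 : Fin 2) = if b then 0 else 1) → a = b := by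
      decide
    exact hc' (x 0) (x 1) (x 2) (x 3) (x 0).2.1 (x 0).2.2 (x 1).2.1 (x 1).2.2 (x 2).2.1 (x 2).2.2
      (x 3).2.1 (x 3).2.2 e ⟨key _ _ (hx 0 3), key _ _ (hx 1 3), key _ _ (hx 2 3)⟩

/-! ### Lower bounds: colorings by three intervals -/

/-- The coloring with `[1, a - 1]` and `[M, N - 1]` in one color and `[a, M - 1]` in the other is
free of monochromatic solutions, if the two families of solutions of the first color that use
elements of the top interval are excluded by `h₁` and `h₂`, where they are forced to have
`k z` strictly between consecutive multiples of `k`. -/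
theorem solutionFree_three_intervals {k a M N : ℕ} (hk : 6 ≤ k) (ha : 4 * a < k + 6) (haM : a ≤ M)
    (hM : 4 * M < (k + 2) * a + 4) (hM' : (k + 2) * a ≤ 4 * M)
    (hN : N ≤ M + M / 2)
    (h₁ : M < N → ∃ Z, k * Z + N + a < 4 * M + 2 ∧ 4 * N < k * (Z + 1) + M + 5)
    (h₂ : M < N → ∃ Z, k * Z + 2 * N < 4 * M + 2 ∧ 4 * N < k * (Z + 1) + 2 * M + 4) :
    SolutionFree k (N - 1) fun n => decide (n < a ∨ M ≤ n) := by
  intro x y z w hx hx' hy hy' hz hz' hw hw' e ⟨cx, cy, cz⟩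
  simp only [decide_eq_decide] at cx cy cz
  have notBetween : ∀ Z, k * Z < k * z → k * z < k * (Z + 1) → False := fun Z l u => by
    have := Nat.lt_of_mul_lt_mul_left l
    have := Nat.lt_of_mul_lt_mul_left u
    omega
  -- A red w below a is too small: 4w ≤ 4a - 4 < k + 2.
  by_cases hwa : w < a
  · have : k * 1 ≤ k * z := Nat.mul_le_mul_left k hz
    omega
  by_cases hwM : M ≤ w
  · by_cases hzM : M ≤ z
    -- `hN` gives 4w < 6M ≤ kz.
    · have h1 : k * M ≤ k * z := Nat.mul_le_mul_left k hzM
      have h2 : 6 * M ≤ k * M := Nat.mul_le_mul_right M hk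
      omega
    have hza : z + 1 ≤ a := by omega
    by_cases hxM : M ≤ x <;> by_cases hyM : M ≤ y
    · obtain ⟨Z, l, u⟩ := h₂ (by omega)
      exact notBetween Z (by omega) (by omega)
    · obtain ⟨Z, l, u⟩ := h₁ (by omega)
      exact notBetween Z (by omega) (by omega)
    · obtain ⟨Z, l, u⟩ := h₁ (by omega)
      exact notBetween Z (by omega) (by omega)
    -- With x, y, z < a the left side is at most (k+2)(a-1) < 4M ≤ 4w.
    · have h1 : k * (z + 1) ≤ k * a := Nat.mul_le_mul_left k hza
      have h2 : k * (z + 1) = k * z + k := by ring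
      have h3 : (k + 2) * a = k * a + 2 * a := by ring
      omega
  -- All four are blue, so 4w ≥ (k+2)a > 4(M-1), contradicting w < M.
  · have hza : a ≤ z := by omega
    have h1 : k * a ≤ k * z := Nat.mul_le_mul_left k hza
    have h3 : (k + 2) * a = k * a + 2 * a := by ring
    omega

/-! ### Upper bounds: the forced red initial segment -/

theorem bool_not_all_eq {p q r s : Bool} (h : ¬ (p = s ∧ q = s ∧ r = s)) :
    (p && q && r && s) = false ∧ (p || q || r || s) = true := by
  revert h; revert p q r s; decide

namespace SolutionFree
variable {k N : ℕ} {c : ℕ → Bool}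

/-- A number is blue if it completes a solution whose other entries are red. -/
theorem w_false (h : SolutionFree k N c) {x y z w : ℕ} (e : x + y + k * z = 4 * w)
    (hx : c x = true) (hy : c y = true) (hz : c z = true)
    (bx : 1 ≤ x ∧ x ≤ N) (bY : 1 ≤ y ∧ y ≤ N) (bz : 1 ≤ z ∧ z ≤ N) (bw : 1 ≤ w ∧ w ≤ N) :
    c w = false := by
  have := h x y z w bx.1 bx.2 bY.1 bY.2 bz.1 bz.2 bw.1 bw.2 e
  cases hw : c w
  · rfl
  · simp_all

theorem w_true (h : SolutionFree k N c) {x y z w : ℕ} (e : x + y + k * z = 4 * w)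
    (hx : c x = false) (hy : c y = false) (hz : c z = false)
    (bx : 1 ≤ x ∧ x ≤ N) (bY : 1 ≤ y ∧ y ≤ N) (bz : 1 ≤ z ∧ z ≤ N) (bw : 1 ≤ w ∧ w ≤ N) :
    c w = true := by
  have := h x y z w bx.1 bx.2 bY.1 bY.2 bz.1 bz.2 bw.1 bw.2 e
  cases hw : c w
  · simp_all
  · rfl

theorem not_red (h : SolutionFree k N c) {x y z w : ℕ} (e : x + y + k * z = 4 * w)
    (hx : c x = true) (hy : c y = true) (hz : c z = true) (hw : c w = true)
    (bx : 1 ≤ x ∧ x ≤ N) (bY : 1 ≤ y ∧ y ≤ N) (bz : 1 ≤ z ∧ z ≤ N) (bw : 1 ≤ w ∧ w ≤ N) :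
    False := by
  simp [h.w_false e hx hy hz bx bY bz bw] at hw

/-- Each solution yields two propositional clauses, one per color; the small cases below are
unsatisfiable sets of such clauses. -/
theorem clause (h : SolutionFree k N c) (x y z w : ℕ) (e : x + y + k * z = 4 * w)
    (bx : 1 ≤ x ∧ x ≤ N) (bY : 1 ≤ y ∧ y ≤ N) (bz : 1 ≤ z ∧ z ≤ N) (bw : 1 ≤ w ∧ w ≤ N) :
    (c x && c y && c z && c w) = false ∧ (c x || c y || c z || c w) = true :=
  bool_not_all_eq (h x y z w bx.1 bx.2 bY.1 bY.2 bz.1 bz.2 bw.1 bw.2 e)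

/-- Let 2 be blue, so k is red. If k+1 is blue, then 4 and 2k+2 are red, k+2 is blue, 2k+6 is red,
and `e9` is all red. If k+1 is red, then 2k+6 is blue (otherwise k-6 and k-2 are blue, against
`e3`), so k+2 is red, 2k+2 and 4 are blue, and `e9` is all blue. -/
theorem two (h : SolutionFree k N c) (h1 : c 1 = true)
    (hk : 7 ≤ k) (hN : 2 * k + 6 ≤ N) : c 2 = true := by
  have e0 := h.clause (k - 6) (2 * k + 6) 1 k (by omega) (by omega) (by omega) (by omega) (by omega)
  have e1 := h.clause (k - 2) (2 * k + 6) 1 (k + 1) (by omega) (by omega) (by omega) (by omega)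
      (by omega)
  have e2 := h.clause (k + 2) (2 * k + 2) 1 (k + 1) (by omega) (by omega) (by omega) (by omega)
      (by omega)
  have e3 := h.clause (k - 6) (k - 2) 2 (k - 2) (by omega) (by omega) (by omega) (by omega)
      (by omega)
  have e4 := h.clause k k 2 k (by omega) (by omega) (by omega) (by omega) (by omega)
  have e5 := h.clause 2 (2 * k + 2) 2 (k + 1) (by omega) (by omega) (by omega) (by omega) (by omega)
  have e6 := h.clause 2 (2 * k + 6) 2 (k + 2) (by omega) (by omega) (by omega) (by omega) (by omega)
  have e7 := h.clause 2 2 4 (k + 1) (by omega) (by omega) (by omega) (by omega) (by omega)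
  have e8 := h.clause 4 4 4 (k + 2) (by omega) (by omega) (by omega) (by omega) (by omega)
  have e9 := h.clause (2 * k + 2) (2 * k + 6) 4 (2 * k + 2) (by omega) (by omega) (by omega)
      (by omega) (by omega)
  grind

/-- If 3 is blue, then successively k+1 is red, 4 is blue and k+2 is red, so `e0` is all red. -/
theorem three (h : SolutionFree k N c) (h2 : c 2 = true)
    (hk : 7 ≤ k) (hN : 2 * k + 6 ≤ N) : c 3 = true := by
  have e0 := h.clause (k + 2) (k + 2) 2 (k + 1) (by omega) (by omega) (by omega) (by omega)
      (by omega)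
  have e1 := h.clause 3 (k + 1) 3 (k + 1) (by omega) (by omega) (by omega) (by omega) (by omega)
  have e2 := h.clause 2 2 4 (k + 1) (by omega) (by omega) (by omega) (by omega) (by omega)
  have e3 := h.clause 4 4 4 (k + 2) (by omega) (by omega) (by omega) (by omega) (by omega)
  grind

/-- If 4 is blue, then k+2 is red, k+4 and 6 are blue, k+3 is red and 10 is blue, so `e5` is all
blue. -/
theorem four (h : SolutionFree k N c) (h2 : c 2 = true) (h3 : c 3 = true)
    (hk : 7 ≤ k) (hN : 2 * k + 6 ≤ N) : c 4 = true := by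
  have e0 := h.clause (k + 4) (k + 4) 2 (k + 2) (by omega) (by omega) (by omega) (by omega)
      (by omega)
  have e1 := h.clause 6 (k + 2) 3 (k + 2) (by omega) (by omega) (by omega) (by omega) (by omega)
  have e2 := h.clause 10 (k + 2) 3 (k + 3) (by omega) (by omega) (by omega) (by omega) (by omega)
  have e3 := h.clause 4 4 4 (k + 2) (by omega) (by omega) (by omega) (by omega) (by omega)
  have e4 := h.clause 6 6 4 (k + 3) (by omega) (by omega) (by omega) (by omega) (by omega)
  have e5 := h.clause 6 10 4 (k + 4) (by omega) (by omega) (by omega) (by omega) (by omega)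
  grind

/-- Since 2 and 4 are red, k and 2k are blue; the same two multiples of k serve for 6. -/
theorem five (h : SolutionFree k N c) (h2 : c 2 = true) (h4 : c 4 = true)
    (hk : 7 ≤ k) (hN : 2 * k + 6 ≤ N) : c 5 = true := by
  have e0 := h.clause k k 2 k (by omega) (by omega) (by omega) (by omega) (by omega)
  have e1 := h.clause (2 * k) (2 * k) 4 (2 * k) (by omega) (by omega) (by omega) (by omega)
      (by omega)
  have e2 := h.clause k (2 * k) 5 (2 * k) (by omega) (by omega) (by omega) (by omega) (by omega)
  grind

theorem six (h : SolutionFree k N c) (h2 : c 2 = true) (h4 : c 4 = true)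
    (hk : 7 ≤ k) (hN : 2 * k + 6 ≤ N) : c 6 = true := by
  have e0 := h.clause k k 2 k (by omega) (by omega) (by omega) (by omega) (by omega)
  have e1 := h.clause (2 * k) (2 * k) 4 (2 * k) (by omega) (by omega) (by omega) (by omega)
      (by omega)
  have e2 := h.clause k k 6 (2 * k) (by omega) (by omega) (by omega) (by omega) (by omega)
  grind

theorem le_six (h : SolutionFree k N c) (h1 : c 1 = true) (hk : 7 ≤ k) (hN : 2 * k + 6 ≤ N) :
    ∀ n, 1 ≤ n → n ≤ 6 → c n = true := by
  have h2 := h.two h1 hk hN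
  have h3 := h.three h2 hk hN
  have h4 := h.four h2 h3 hk hN
  have h5 := h.five h2 h4 hk hN
  have h6 := h.six h2 h4 hk hN
  intro n hn hn'
  interval_cases n <;> assumption

/-- All numbers up to `4 m - 2` have the color of `1`: if `2 j` is red then `j k` is blue, and
these blue multiples of `k` force further red numbers. -/
theorem initial_red (h : SolutionFree k N c) (h1 : c 1 = true) (hk : 7 ≤ k)
    (hN : 2 * k + 6 ≤ N) {m : ℕ} (hm : 2 ≤ m) (hmN : k * m ≤ N) :
    ∀ n, 1 ≤ n → n + 2 ≤ 4 * m → c n = true := by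
  induction m, hm using Nat.le_induction with
  | base =>
    intro n hn hn'
    exact h.le_six h1 hk hN n hn (by omega)
  | succ m hm ih =>
    have hmN' : k * m ≤ N := (Nat.mul_le_mul_left k (by omega)).trans hmN
    have ih := ih hmN'
    have h7 : 7 * (m + 1) ≤ k * (m + 1) := Nat.mul_le_mul_right _ hk
    have bound : ∀ j, 1 ≤ j → j ≤ m + 1 → 1 ≤ k * j ∧ k * j ≤ N := fun j hj hj' =>
      ⟨Nat.mul_pos (by omega) hj, (Nat.mul_le_mul_left k hj').trans hmN⟩
    have blue : ∀ j, 1 ≤ j → j ≤ m + 1 → c (k * j) = false := by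
      intro j hj hj'
      have b := bound j hj hj'
      cases hc : c (k * j)
      · rfl
      · exact (h.not_red (x := k * j) (y := k * j) (z := 2 * j) (w := k * j) (by ring) hc hc
          (ih _ (by omega) (by omega)) hc b b (by omega) b).elim
    intro n hn hn'
    by_cases hnm : n + 2 ≤ 4 * m
    · exact ih n hn hnm
    -- Multiplying by k turns n + x + y = 4(m+1) into a solution with z = n whose other entries kx,
    -- ky, k(m+1) are blue.
    obtain ⟨x, y, hx, hy, hxm, hym, hxy⟩ : ∃ x y, 1 ≤ x ∧ 1 ≤ y ∧ x ≤ m + 1 ∧ y ≤ m + 1 ∧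
        n + x + y = 4 * (m + 1) := by
      by_cases h2 : n + 3 ≤ 4 * (m + 1)
      · by_cases h3 : n + 4 ≤ 4 * (m + 1)
        · exact ⟨2, 4 * (m + 1) - n - 2, by omega, by omega, by omega, by omega, by omega⟩
        · exact ⟨1, 2, by omega, by omega, by omega, by omega, by omega⟩
      · exact ⟨1, 1, by omega, by omega, by omega, by omega, by omega⟩
    cases hc : c n
    · have := h.w_true (x := k * x) (y := k * y) (z := n) (w := k * (m + 1))
        (by rw [← Nat.mul_add, ← Nat.mul_add, show x + y + n = 4 * (m + 1) by omega]; ring)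
        (blue x hx hxm) (blue y hy hym) hc (bound x hx hxm) (bound y hy hym) (by omega)
        (bound _ (by omega) le_rfl)
      rw [blue (m + 1) (by omega) le_rfl] at this
      cases this
    · rfl

/-- If `[1, R]` is red, then so many numbers `w` are blue. -/
theorem blue_of_red (h : SolutionFree k N c) {R : ℕ} (hR : ∀ n, 1 ≤ n → n ≤ R → c n = true)
    (hRN : R ≤ N) {w : ℕ} (z s : ℕ) (e : 4 * w = k * z + s) (hz : 1 ≤ z) (hz' : z ≤ R)
    (hs : 2 ≤ s) (hs' : s ≤ 2 * R) (hw : w ≤ N) : c w = false :=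
  h.w_false (x := s / 2) (y := s - s / 2) (z := z) (by omega) (hR _ (by omega) (by omega))
    (hR _ (by omega) (by omega)) (hR _ hz hz') (by omega) (by omega) (by omega) (by omega)

end SolutionFree

/-! ### Upper bounds for large k -/

/-- The upper bound for `k ≡ 11, 12, 13, 14 (mod 16)`, apart from some small `k`. -/
theorem not_solutionFree_eleven_to_fourteen {k m d N : ℕ} {c : ℕ → Bool} (hm : 2 ≤ m) (hk :
    k + d = 16 * m)
    (hd : 2 ≤ d) (hd' : d ≤ 5) (hN : N = k * m + 4 * m) (h1 : c 1 = true) :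
    ¬ SolutionFree k N c := by
  intro h
  have hkm : k * 2 ≤ k * m := Nat.mul_le_mul_left k hm
  have red := h.initial_red h1 (by omega) (by omega) hm (by omega)
  have red' : ∀ n, 1 ≤ n → n ≤ 4 * m - 2 → c n = true := fun n hn hn' => red n hn (by omega)
  have b4 : c (4 * m) = false := h.blue_of_red red' (by omega) 1 d
    (by omega) (by omega) (by omega) hd (by omega) (by omega)
  have b8 : c (8 * m) = false := h.blue_of_red red' (by omega) 2 (2 * d)
    (by omega) (by omega) (by omega) (by omega) (by omega) (by omega)
  have rN : c N = true := h.w_true (x := 8 * m) (y := 8 * m) (z := 4 * m) (by rw [hN]; ring)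
    b8 b8 b4 (by omega) (by omega) (by omega) (by omega)
  have rM : c (k * m + 2 * m) = true := h.w_true (x := 4 * m) (y := 4 * m) (z := 4 * m) (by ring)
    b4 b4 b4 (by omega) (by omega) (by omega) (by omega)
  -- The equality 2N + 2mk = 4M, with M = km + 2m, is exactly what stops the top interval of the
  -- extremal coloring at N.
  exact h.not_red (x := N) (y := N) (z := 2 * m) (by rw [hN]; ring) rN rN
    (red _ (by omega) (by omega)) rM (by omega) (by omega) (by omega) (by omega)

/-- The upper bound for `k ≡ 15, 0, 1, 2 (mod 16)`, apart from some small `k`. -/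
theorem not_solutionFree_fifteen_to_two {k m d N : ℕ} {c : ℕ → Bool} (hm : 3 ≤ m) (hk :
    k + d = 16 * m + 2)
    (hd : d ≤ 3) (hN : N = k * m + 6 * m + 1) (h1 : c 1 = true) :
    ¬ SolutionFree k N c := by
  intro h
  have hkm : k * 3 ≤ k * m := Nat.mul_le_mul_left k hm
  have red := h.initial_red h1 (by omega) (by omega) (by omega : 2 ≤ m) (by omega)
  have red' : ∀ n, 1 ≤ n → n ≤ 4 * m - 2 → c n = true := fun n hn hn' => red n hn (by omega)
  have ba : c (4 * m + 1) = false := h.blue_of_red red' (by omega) 1 (d + 2)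
    (by omega) (by omega) (by omega) (by omega) (by omega) (by omega)
  have bad : c (4 * m + 1 + d) = false := h.blue_of_red red' (by omega) 1 (5 * d + 2)
    (by omega) (by omega) (by omega) (by omega) (by omega) (by omega)
  have e1 : k * (4 * m + 1) = 4 * (k * m) + k := by ring
  have e2 : k * (3 * m + 1) = 3 * (k * m) + k := by ring
  -- The shift by d makes a + (a+d) + ka equal to 4N, where a = 4m + 1.
  have rN : c N = true := h.w_true (x := 4 * m + 1) (y := 4 * m + 1 + d) (z := 4 * m + 1)
    (by omega) ba bad ba (by omega) (by omega) (by omega) (by omega)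
  exact h.not_red (x := N) (y := 2 * m + 1 + d) (z := 3 * m + 1) (by omega) rN
    (red _ (by omega) (by omega)) (red _ (by omega) (by omega)) rN
    (by omega) (by omega) (by omega) (by omega)

/-- The upper bound for `k ≡ 7, 8, 9, 10 (mod 16)`, apart from some small `k`. -/
theorem not_solutionFree_seven_to_ten {k m d N : ℕ} {c : ℕ → Bool} (hm : 2 ≤ m) (hk :
    k + d = 16 * m + 10)
    (hd : d ≤ 3) (hN : N + d = k * m + 15 * m + 10) (h1 : c 1 = true) :
    ¬ SolutionFree k N c := by
  intro h
  have hkm : k * 2 ≤ k * m := Nat.mul_le_mul_left k hm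
  have red := h.initial_red h1 (by omega) (by omega) hm (by omega)
  have red' : ∀ n, 1 ≤ n → n ≤ 4 * m - 2 → c n = true := fun n hn hn' => red n hn (by omega)
  have blue₁ : ∀ w, 4 * m + 3 ≤ w → 4 * w ≤ k + 12 → c w = false := fun w hw hw' =>
    h.blue_of_red red' (by omega) 1 (4 * w - k) (by omega) (by omega) (by omega) (by omega)
      (by omega) (by omega)
  have blue₂ : ∀ w, 8 * m + 4 ≤ w → 2 * k + 2 ≤ 4 * w → 4 * w ≤ 2 * k + 12 → c w = false :=
    fun w hw hw' hw'' => h.blue_of_red red' (by omega) 2 (4 * w - 2 * k) (by omega) (by omega)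
      (by omega) (by omega) (by omega) (by omega)
  have e1 : k * (4 * m + 3) = 4 * (k * m) + 3 * k := by ring
  have e2 : k * (2 * m + 2) = 2 * (k * m) + 2 * k := by ring
  have ba : c (4 * m + 3) = false := blue₁ _ le_rfl (by omega)
  -- With a = 4m + 3, one needs u + v = 4N - ka, which is about 3a: u is taken from the blue window
  -- near a, v from the one near 2a.
  obtain ⟨u, v, hu, hu', hv, hv', huv⟩ : ∃ u v, 4 * m + 3 ≤ u ∧ 4 * u ≤ k + 12 ∧
      2 * k + 2 ≤ 4 * v ∧ 4 * v ≤ 2 * k + 12 ∧ u + v + d = 12 * m + 10 := by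
    have : d = 0 ∨ d = 1 ∨ d = 2 ∨ d = 3 := by omega
    obtain rfl | rfl | rfl | rfl := this
    · exact ⟨4 * m + 4, 8 * m + 6, by omega, by omega, by omega, by omega, by omega⟩
    · exact ⟨4 * m + 4, 8 * m + 5, by omega, by omega, by omega, by omega, by omega⟩
    · exact ⟨4 * m + 3, 8 * m + 5, by omega, by omega, by omega, by omega, by omega⟩
    · exact ⟨4 * m + 3, 8 * m + 4, by omega, by omega, by omega, by omega, by omega⟩
  have rN : c N = true := h.w_true (x := u) (y := v) (z := 4 * m + 3) (by omega)
    (blue₁ u hu hu') (blue₂ v (by omega) hv hv') ba (by omega) (by omega) (by omega) (by omega)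
  obtain ⟨s, t, hs, hs', ht, ht', hst⟩ : ∃ s t, 4 * m + 3 ≤ s ∧ 4 * s ≤ k + 12 ∧
      4 * m + 3 ≤ t ∧ 4 * t ≤ k + 12 ∧ s + t + d = 8 * m + 10 := by
    have : d = 0 ∨ d = 1 ∨ d = 2 ∨ d = 3 := by omega
    obtain rfl | rfl | rfl | rfl := this
    · exact ⟨4 * m + 5, 4 * m + 5, by omega, by omega, by omega, by omega, by omega⟩
    · exact ⟨4 * m + 4, 4 * m + 5, by omega, by omega, by omega, by omega, by omega⟩
    · exact ⟨4 * m + 4, 4 * m + 4, by omega, by omega, by omega, by omega, by omega⟩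
    · exact ⟨4 * m + 3, 4 * m + 4, by omega, by omega, by omega, by omega, by omega⟩
  have rM : c (k * m + 14 * m + 10 - d) = true := h.w_true (x := s) (y := t) (z := 4 * m + 3)
    (by omega) (blue₁ s hs hs') (blue₁ t ht ht') ba (by omega) (by omega) (by omega) (by omega)
  exact h.not_red (z := 2 * m + 2) (w := N) (by omega) rM rM (red _ (by omega) (by omega)) rN
    (by omega) (by omega) (by omega) (by omega)

/-- The upper bound for `k ≡ 3, 4, 5, 6 (mod 16)`, apart from some small `k`. -/
theorem not_solutionFree_three_to_six {k m d e f t y M N : ℕ} {c : ℕ → Bool} (hm : 4 ≤ m)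
    (hk : k + d = 16 * m + 6) (hd : d ≤ 3) (hdf : d = 2 * f + e) (he : e ≤ 1)
    (hy : 1 ≤ y) (hy' : y ≤ 4) (ht : y + 2 * m + 3 * f = 4 * t + 2 * d)
    (hM : M + f = k * m + 10 * m + 4) (hN : N = M + t) (h1 : c 1 = true) :
    ¬ SolutionFree k N c := by
  intro h
  have hkm : k * 4 ≤ k * m := Nat.mul_le_mul_left k hm
  have red := h.initial_red h1 (by omega) (by omega) (by omega : 2 ≤ m) (by omega)
  have red' : ∀ n, 1 ≤ n → n ≤ 4 * m - 2 → c n = true := fun n hn hn' => red n hn (by omega)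
  have blue : ∀ u, 4 * u + d + 6 ≤ 8 * m → c (4 * m + 2 + u) = false := fun u hu =>
    h.blue_of_red red' (by omega) 1 (2 + d + 4 * u) (by omega) (by omega) (by omega) (by omega)
      (by omega) (by omega)
  have e1 : k * (4 * m + 2) = 4 * (k * m) + 2 * k := by ring
  have e2 : k * (3 * m + 2) = 3 * (k * m) + 2 * k := by ring
  have ba : c (4 * m + 2 + 0) = false := blue 0 (by omega)
  have bN := blue (e + 2 * t) (by omega)
  -- With a = 4m + 2, the remainder e gives (k+2)a + 2e = 4M. Raising both x and y from a to a + e +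
  -- 2t therefore yields 4(M+t) = 4N.
  have rN : c N = true := h.w_true (z := 4 * m + 2 + 0) (by rw [add_zero]; omega) bN bN ba
    (by omega) (by omega) (by omega) (by omega)
  have rM : c M = true := h.w_true (z := 4 * m + 2 + 0) (by rw [add_zero]; omega) ba
    (blue (2 * e) (by omega)) ba (by omega) (by omega) (by omega) (by omega)
  exact h.not_red (x := M) (y := y) (z := 3 * m + 2) (w := N) (by omega) rM
    (red _ (by omega) (by omega)) (red _ (by omega) (by omega)) rN
    (by omega) (by omega) (by omega) (by omega)

/-! ### Upper bounds for small k by backtracking -/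

/-- Does the list `L` contain `x, y, z, w` with `x + y + k z = 4 w`? -/
def hasSolution (k : ℕ) (L : List ℕ) : Bool :=
  L.any fun z => L.any fun w => k * z < 4 * w && L.any fun x => L.elem (4 * w - k * z - x)

/-- Backtracking search over the colorings of the listed numbers. -/
def refutes (k : ℕ) : List ℕ → List ℕ → List ℕ → Bool
  | [], _, _ => false
  | v :: vs, R, B =>
    (hasSolution k (v :: R) || refutes k vs (v :: R) B) &&
      (hasSolution k (v :: B) || refutes k vs R (v :: B))

theorem SolutionFree.hasSolution_eq_false {k N : ℕ} {c : ℕ → Bool} (h : SolutionFree k N c)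
    {L : List ℕ} {b : Bool} (hL : ∀ n ∈ L, 1 ≤ n ∧ n ≤ N) (hc : ∀ n ∈ L, c n = b) :
    hasSolution k L = false := by
  by_contra hs
  rw [Bool.not_eq_false] at hs
  simp only [hasSolution, List.any_eq_true, Bool.and_eq_true, List.elem_iff,
    decide_eq_true_eq] at hs
  obtain ⟨z, hz, w, hw, -, x, hx, hy⟩ := hs
  -- Positivity of y = 4w - kz - x shows that the subtraction is not truncated.
  have := (hL _ hy).1
  refine h x _ z w (hL x hx).1 (hL x hx).2 (hL _ hy).1 (hL _ hy).2 (hL z hz).1 (hL z hz).2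
    (hL w hw).1 (hL w hw).2 (by omega) ?_
  rw [hc _ hx, hc _ hy, hc _ hz, hc _ hw]
  exact ⟨rfl, rfl, rfl⟩

theorem not_solutionFree_of_refutes {k N : ℕ} {c : ℕ → Bool} {vs R B : List ℕ}
    (hr : refutes k vs R B = true) (hv : ∀ n ∈ vs, 1 ≤ n ∧ n ≤ N)
    (hR : ∀ n ∈ R, (1 ≤ n ∧ n ≤ N) ∧ c n = true) (hB : ∀ n ∈ B, (1 ≤ n ∧ n ≤ N) ∧ c n = false) :
    ¬ SolutionFree k N c := by
  intro h
  induction vs generalizing R B with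
  | nil => simp [refutes] at hr
  | cons v vs ih =>
    have hv1 := hv v (by simp)
    have hvs : ∀ n ∈ vs, 1 ≤ n ∧ n ≤ N := fun n hn => hv n (by simp [hn])
    rw [refutes, Bool.and_eq_true, Bool.or_eq_true, Bool.or_eq_true] at hr
    cases hc : c v
    · have hB' : ∀ n ∈ v :: B, (1 ≤ n ∧ n ≤ N) ∧ c n = false := by
        simpa [hc, hv1] using hB
      obtain hr | hr := hr.2
      · simp [h.hasSolution_eq_false (fun n hn => (hB' n hn).1) (fun n hn => (hB' n hn).2)] at hr
      · exact ih hr hvs hR hB'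
    · have hR' : ∀ n ∈ v :: R, (1 ≤ n ∧ n ≤ N) ∧ c n = true := by
        simpa [hc, hv1] using hR
      obtain hr | hr := hr.1
      · simp [h.hasSolution_eq_false (fun n hn => (hR' n hn).1) (fun n hn => (hR' n hn).2)] at hr
      · exact ih hr hvs hR' hB

theorem not_solutionFree_of_one {k N : ℕ} {c : ℕ → Bool} (vs : List ℕ) (h1 : c 1 = true)
    (hN : 1 ≤ N)
    (hvs : (vs.all (fun n => decide (1 ≤ n ∧ n ≤ N)) && refutes k vs [1] []) = true) :
    ¬ SolutionFree k N c := by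
  rw [Bool.and_eq_true, List.all_eq_true] at hvs
  exact not_solutionFree_of_refutes hvs.2 (fun n hn => of_decide_eq_true (hvs.1 n hn))
    (by simpa [h1] using hN) (by simp)

/-- Starting from red numbers supplied by `SolutionFree.initial_red` keeps the search short. -/
theorem not_solutionFree_of_initial {k N m : ℕ} {c : ℕ → Bool} (R vs : List ℕ) (h1 : c 1 = true)
    (hk : 7 ≤ k) (hN : 2 * k + 6 ≤ N) (hm : 2 ≤ m) (hmN : k * m ≤ N)
    (hR : (R.all fun n => decide (1 ≤ n ∧ n + 2 ≤ 4 * m)) = true)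
    (hvs : (vs.all (fun n => decide (1 ≤ n ∧ n ≤ N)) && refutes k vs R []) = true) :
    ¬ SolutionFree k N c := by
  intro h
  have red := h.initial_red h1 hk hN hm hmN
  rw [Bool.and_eq_true, List.all_eq_true] at hvs
  rw [List.all_eq_true] at hR
  have h7 : 7 * m ≤ k * m := Nat.mul_le_mul_right m hk
  refine not_solutionFree_of_refutes hvs.2 (fun n hn => of_decide_eq_true (hvs.1 n hn))
    (fun n hn => ?_) (by simp) h
  have := of_decide_eq_true (hR n hn)
  exact ⟨by omega, red n this.1 this.2⟩

theorem not_solutionFree_6 {c : ℕ → Bool} (h1 : c 1 = true) : ¬ SolutionFree 6 5 c :=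
  not_solutionFree_of_one [3, 2, 4, 5] h1 (by decide) (by decide +kernel)

theorem not_solutionFree_7 {c : ℕ → Bool} (h1 : c 1 = true) : ¬ SolutionFree 7 7 c :=
  not_solutionFree_of_one [2, 7, 5, 4, 3, 6] h1 (by decide) (by decide +kernel)

theorem not_solutionFree_8 {c : ℕ → Bool} (h1 : c 1 = true) : ¬ SolutionFree 8 8 c :=
  not_solutionFree_of_one [4, 3, 8, 6, 2] h1 (by decide) (by decide +kernel)

theorem not_solutionFree_9 {c : ℕ → Bool} (h1 : c 1 = true) : ¬ SolutionFree 9 9 c :=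
  not_solutionFree_of_one [2, 9, 3, 6, 4, 5] h1 (by decide) (by decide +kernel)

theorem not_solutionFree_10 {c : ℕ → Bool} (h1 : c 1 = true) : ¬ SolutionFree 10 10 c :=
  not_solutionFree_of_one [5, 3, 10, 2, 7, 6] h1 (by decide) (by decide +kernel)

theorem not_solutionFree_11 {c : ℕ → Bool} (h1 : c 1 = true) : ¬ SolutionFree 11 15 c :=
  not_solutionFree_of_one [4, 13, 8, 15, 2] h1 (by decide) (by decide +kernel)

theorem not_solutionFree_12 {c : ℕ → Bool} (h1 : c 1 = true) : ¬ SolutionFree 12 16 c :=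
  not_solutionFree_of_one [6, 14, 4, 3, 10, 2, 16] h1 (by decide) (by decide +kernel)

theorem not_solutionFree_13 {c : ℕ → Bool} (h1 : c 1 = true) : ¬ SolutionFree 13 17 c :=
  not_solutionFree_of_one [8, 14, 3, 2, 11, 4, 15, 17] h1 (by decide) (by decide +kernel)

theorem not_solutionFree_14 {c : ℕ → Bool} (h1 : c 1 = true) : ¬ SolutionFree 14 18 c :=
  not_solutionFree_of_one [4, 16, 10, 2, 18, 8] h1 (by decide) (by decide +kernel)

theorem not_solutionFree_15 {c : ℕ → Bool} (h1 : c 1 = true) : ¬ SolutionFree 15 24 c :=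
  not_solutionFree_of_one [15, 2, 10, 5, 3, 12, 16, 24, 23] h1 (by decide) (by decide +kernel)

theorem not_solutionFree_17 {c : ℕ → Bool} (h1 : c 1 = true) : ¬ SolutionFree 17 24 c :=
  not_solutionFree_of_one [6, 4, 24, 19, 3, 15, 5, 2] h1 (by decide) (by decide +kernel)

theorem not_solutionFree_18 {c : ℕ → Bool} (h1 : c 1 = true) : ¬ SolutionFree 18 25 c :=
  not_solutionFree_of_one [5, 25, 17, 11, 3, 20, 4] h1 (by decide) (by decide +kernel)

theorem not_solutionFree_19 {c : ℕ → Bool} (h1 : c 1 = true) : ¬ SolutionFree 19 32 c :=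
  not_solutionFree_of_one [4, 21, 2, 20, 25, 13, 10, 7, 5, 32, 6, 28] h1 (by decide)
      (by decide +kernel)

theorem not_solutionFree_20 {c : ℕ → Bool} (h1 : c 1 = true) : ¬ SolutionFree 20 34 c :=
  not_solutionFree_of_one [10, 3, 30, 20, 2, 25, 5, 34, 6] h1 (by decide) (by decide +kernel)

theorem not_solutionFree_21 {c : ℕ → Bool} (h1 : c 1 = true) : ¬ SolutionFree 21 36 c :=
  not_solutionFree_of_one [6, 2, 21, 12, 3, 15, 9, 36, 5, 33] h1 (by decide) (by decide +kernel)

theorem not_solutionFree_22 {c : ℕ → Bool} (h1 : c 1 = true) : ¬ SolutionFree 22 37 c :=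
  not_solutionFree_of_one [11, 6, 5, 37, 33, 8, 22, 3] h1 (by decide) (by decide +kernel)

theorem not_solutionFree_23 {c : ℕ → Bool} (h1 : c 1 = true) : ¬ SolutionFree 23 45 c :=
  not_solutionFree_of_one [8, 2, 16, 12, 25, 4, 27, 7, 44, 45] h1 (by decide) (by decide +kernel)

theorem not_solutionFree_24 {c : ℕ → Bool} (h1 : c 1 = true) : ¬ SolutionFree 24 47 c :=
  not_solutionFree_of_one [12, 3, 36, 4, 20, 2, 8, 7, 46, 47] h1 (by decide) (by decide +kernel)

theorem not_solutionFree_25 {c : ℕ → Bool} (h1 : c 1 = true) : ¬ SolutionFree 25 49 c :=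
  not_solutionFree_of_one [42, 5, 17, 26, 3, 39, 4, 27, 2, 9, 15, 14, 7, 10, 49, 48] h1
      (by decide) (by decide +kernel)

theorem not_solutionFree_26 {c : ℕ → Bool} (h1 : c 1 = true) : ¬ SolutionFree 26 51 c :=
  not_solutionFree_of_one [9, 13, 7, 49, 31, 51, 4] h1 (by decide) (by decide +kernel)

theorem not_solutionFree_31 {c : ℕ → Bool} (h1 : c 1 = true) : ¬ SolutionFree 31 75 c :=
  not_solutionFree_of_initial (m := 2) (List.range' 1 6) [9, 12, 75, 35, 66, 8, 7] h1
    (by decide) (by decide) (by decide) (by decide) (by decide) (by decide +kernel)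

theorem not_solutionFree_32 {c : ℕ → Bool} (h1 : c 1 = true) : ¬ SolutionFree 32 77 c :=
  not_solutionFree_of_initial (m := 2) (List.range' 1 6) [9, 10, 77, 60, 7] h1
    (by decide) (by decide) (by decide) (by decide) (by decide) (by decide +kernel)

theorem not_solutionFree_33 {c : ℕ → Bool} (h1 : c 1 = true) : ¬ SolutionFree 33 79 c :=
  not_solutionFree_of_initial (m := 2) (List.range' 1 6) [10, 9, 26, 66, 7, 79] h1
    (by decide) (by decide) (by decide) (by decide) (by decide) (by decide +kernel)

theorem not_solutionFree_34 {c : ℕ → Bool} (h1 : c 1 = true) : ¬ SolutionFree 34 81 c :=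
  not_solutionFree_of_initial (m := 2) (List.range' 1 6) [7, 63, 9, 81] h1
    (by decide) (by decide) (by decide) (by decide) (by decide) (by decide +kernel)

theorem not_solutionFree_35 {c : ℕ → Bool} (h1 : c 1 = true) : ¬ SolutionFree 35 94 c :=
  not_solutionFree_of_initial (m := 2) (List.range' 1 6) [13, 10, 24, 94, 78, 8] h1
    (by decide) (by decide) (by decide) (by decide) (by decide) (by decide +kernel)

theorem not_solutionFree_36 {c : ℕ → Bool} (h1 : c 1 = true) : ¬ SolutionFree 36 96 c :=
  not_solutionFree_of_initial (m := 2) (List.range' 1 6) [14, 10, 95, 78, 8, 96] h1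
    (by decide) (by decide) (by decide) (by decide) (by decide) (by decide +kernel)

theorem not_solutionFree_37 {c : ℕ → Bool} (h1 : c 1 = true) : ¬ SolutionFree 37 99 c :=
  not_solutionFree_of_initial (m := 2) (List.range' 1 6) [10, 13, 99, 20, 81, 8] h1
    (by decide) (by decide) (by decide) (by decide) (by decide) (by decide +kernel)

theorem not_solutionFree_38 {c : ℕ → Bool} (h1 : c 1 = true) : ¬ SolutionFree 38 102 c :=
  not_solutionFree_of_initial (m := 2) (List.range' 1 6) [10, 14, 26, 102, 89, 8] h1
    (by decide) (by decide) (by decide) (by decide) (by decide) (by decide +kernel)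

theorem not_solutionFree_51 {c : ℕ → Bool} (h1 : c 1 = true) : ¬ SolutionFree 51 187 c :=
  not_solutionFree_of_initial (m := 3) (List.range' 1 10) [17, 14, 172, 187, 111, 16, 186, 11] h1
    (by decide) (by decide) (by decide) (by decide) (by decide) (by decide +kernel)

theorem not_solutionFree_52 {c : ℕ → Bool} (h1 : c 1 = true) : ¬ SolutionFree 52 191 c :=
  not_solutionFree_of_initial (m := 3) (List.range' 1 10) [19, 37, 157, 17, 11, 14, 191] h1
    (by decide) (by decide) (by decide) (by decide) (by decide) (by decide +kernel)

theorem not_solutionFree_53 {c : ℕ → Bool} (h1 : c 1 = true) : ¬ SolutionFree 53 195 c :=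
  not_solutionFree_of_initial (m := 3) (List.range' 1 10) [19, 14, 126, 180, 11, 195] h1
    (by decide) (by decide) (by decide) (by decide) (by decide) (by decide +kernel)

theorem not_solutionFree_54 {c : ℕ → Bool} (h1 : c 1 = true) : ¬ SolutionFree 54 198 c :=
  not_solutionFree_of_initial (m := 3) (List.range' 1 10) [14, 18, 164, 31, 11, 196, 198] h1
    (by decide) (by decide) (by decide) (by decide) (by decide) (by decide +kernel)

/-! ### Rado numbers by residue class -/

/-- The Rado number for `k ≡ 11, 12, 13, 14 (mod 16)`. -/
theorem isRadoNumber_eleven_to_fourteen {k m d N : ℕ} (hm : 1 ≤ m) (hk : k + d = 16 * m) (hd :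
    2 ≤ d)
    (hd' : d ≤ 5) (hN : N = k * m + 4 * m) : IsRadoNumber 2 (radoEquation k) N := by
  have h6 : 6 * m ≤ k * m := Nat.mul_le_mul_right m (by omega)
  refine isRadoNumber_radoEquation (by omega) (fun c h1 => ?_) ⟨_, solutionFree_three_intervals
    (a := 4 * m) (M := k * m + 2 * m) (by omega) (by omega) (by omega) (by linarith) (by linarith)
    (by omega) (fun _ => ⟨3 * m, by linarith, by linarith⟩)
    (fun _ => ⟨2 * m, by linarith, by linarith⟩)⟩
  by_cases hm2 : 2 ≤ m
  · exact not_solutionFree_eleven_to_fourteen hm2 hk hd hd' hN h1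
  obtain rfl : m = 1 := by omega
  have : d = 2 ∨ d = 3 ∨ d = 4 ∨ d = 5 := by omega
  obtain rfl | rfl | rfl | rfl := this
  · obtain ⟨rfl, rfl⟩ : k = 14 ∧ N = 18 := by omega
    exact not_solutionFree_14 h1
  · obtain ⟨rfl, rfl⟩ : k = 13 ∧ N = 17 := by omega
    exact not_solutionFree_13 h1
  · obtain ⟨rfl, rfl⟩ : k = 12 ∧ N = 16 := by omega
    exact not_solutionFree_12 h1
  · obtain ⟨rfl, rfl⟩ : k = 11 ∧ N = 15 := by omega
    exact not_solutionFree_11 h1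

/-- The Rado number for `k ≡ 15, 0, 1, 2 (mod 16)`. -/
theorem isRadoNumber_fifteen_to_two {k m d N : ℕ} (hm : 1 ≤ m) (hk : k + d = 16 * m + 2) (hd :
    d ≤ 3)
    (h15 : k ≠ 15) (h16 : k ≠ 16) (hN : N = k * m + 6 * m + 1) :
    IsRadoNumber 2 (radoEquation k) N := by
  have h6 : 6 * m ≤ k * m := Nat.mul_le_mul_right m (by omega)
  have e : (k + 2) * (4 * m + 1) = 4 * (k * m) + k + 8 * m + 2 := by ring
  refine isRadoNumber_radoEquation (by omega) (fun c h1 => ?_) ⟨_, solutionFree_three_intervals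
    (a := 4 * m + 1) (M := N) (by omega) (by omega) (by omega) (by omega) (by omega)
    (by omega) (fun h => absurd h (lt_irrefl _)) (fun h => absurd h (lt_irrefl _))⟩
  by_cases hm3 : 3 ≤ m
  · exact not_solutionFree_fifteen_to_two hm3 hk hd hN h1
  have hm' : m = 1 ∨ m = 2 := by omega
  have hd4 : d = 0 ∨ d = 1 ∨ d = 2 ∨ d = 3 := by omega
  obtain rfl | rfl := hm'
  · have : k = 17 ∨ k = 18 := by omega
    obtain rfl | rfl := this
    · obtain rfl : N = 24 := by omega
      exact not_solutionFree_17 h1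
    · obtain rfl : N = 25 := by omega
      exact not_solutionFree_18 h1
  · obtain rfl | rfl | rfl | rfl := hd4
    · obtain ⟨rfl, rfl⟩ : k = 34 ∧ N = 81 := by omega
      exact not_solutionFree_34 h1
    · obtain ⟨rfl, rfl⟩ : k = 33 ∧ N = 79 := by omega
      exact not_solutionFree_33 h1
    · obtain ⟨rfl, rfl⟩ : k = 32 ∧ N = 77 := by omega
      exact not_solutionFree_32 h1
    · obtain ⟨rfl, rfl⟩ : k = 31 ∧ N = 75 := by omega
      exact not_solutionFree_31 h1

/-- The Rado number for `k ≡ 7, 8, 9, 10 (mod 16)`. -/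
theorem isRadoNumber_seven_to_ten {k m d N : ℕ} (hk : k + d = 16 * m + 10) (hd : d ≤ 3)
    (hN : N + d = k * m + 15 * m + 10) : IsRadoNumber 2 (radoEquation k) N := by
  have h6 : 6 * m ≤ k * m := Nat.mul_le_mul_right m (by omega)
  have e : (k + 2) * (4 * m + 3) = 4 * (k * m) + 3 * k + 8 * m + 6 := by ring
  have e1 : k * (3 * m + 2) = 3 * (k * m) + 2 * k := by ring
  have e2 : k * (3 * m + 2 + 1) = 3 * (k * m) + 3 * k := by ring
  have e3 : k * (2 * m + 1) = 2 * (k * m) + k := by ring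
  have e4 : k * (2 * m + 1 + 1) = 2 * (k * m) + 2 * k := by ring
  refine isRadoNumber_radoEquation (by omega) (fun c h1 => ?_) ⟨_, solutionFree_three_intervals
    -- Truncated subtraction is intended: ⌈(k+2)a/4⌉ has constant term 9, 9, 8, 7 for d = 0, 1, 2,
    -- 3.
    (a := 4 * m + 3) (M := k * m + 14 * m + 9 - (d - 1)) (by omega) (by omega) (by omega)
    (by omega) (by omega) (by omega) (fun _ => ⟨3 * m + 2, by omega, by omega⟩)
    (fun _ => ⟨2 * m + 1, by omega, by omega⟩)⟩
  by_cases hm2 : 2 ≤ m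
  · exact not_solutionFree_seven_to_ten hm2 hk hd hN h1
  have hm' : m = 0 ∨ m = 1 := by omega
  have hd4 : d = 0 ∨ d = 1 ∨ d = 2 ∨ d = 3 := by omega
  obtain rfl | rfl := hm'
  · obtain rfl | rfl | rfl | rfl := hd4
    · obtain ⟨rfl, rfl⟩ : k = 10 ∧ N = 10 := by omega
      exact not_solutionFree_10 h1
    · obtain ⟨rfl, rfl⟩ : k = 9 ∧ N = 9 := by omega
      exact not_solutionFree_9 h1
    · obtain ⟨rfl, rfl⟩ : k = 8 ∧ N = 8 := by omega
      exact not_solutionFree_8 h1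
    · obtain ⟨rfl, rfl⟩ : k = 7 ∧ N = 7 := by omega
      exact not_solutionFree_7 h1
  · obtain rfl | rfl | rfl | rfl := hd4
    · obtain ⟨rfl, rfl⟩ : k = 26 ∧ N = 51 := by omega
      exact not_solutionFree_26 h1
    · obtain ⟨rfl, rfl⟩ : k = 25 ∧ N = 49 := by omega
      exact not_solutionFree_25 h1
    · obtain ⟨rfl, rfl⟩ : k = 24 ∧ N = 47 := by omega
      exact not_solutionFree_24 h1
    · obtain ⟨rfl, rfl⟩ : k = 23 ∧ N = 45 := by omega
      exact not_solutionFree_23 h1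

/-- The Rado number for `k ≡ 3, 4, 5, 6 (mod 16)`. -/
theorem isRadoNumber_three_to_six {k m d e f t y M N : ℕ} (hk6 : 6 ≤ k)
    (hk : k + d = 16 * m + 6) (hd : d ≤ 3) (hdf : d = 2 * f + e) (he : e ≤ 1)
    (hy : 1 ≤ y) (hy' : y ≤ 4) (ht : y + 2 * m + 3 * f = 4 * t + 2 * d)
    (hM : M + f = k * m + 10 * m + 4) (hN : N = M + t) :
    IsRadoNumber 2 (radoEquation k) N := by
  have h6 : 6 * m ≤ k * m := Nat.mul_le_mul_right m hk6
  have e0 : (k + 2) * (4 * m + 2) = 4 * (k * m) + 2 * k + 8 * m + 4 := by ring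
  have e1 : k * (3 * m + 1) = 3 * (k * m) + k := by ring
  have e2 : k * (3 * m + 1 + 1) = 3 * (k * m) + 2 * k := by ring
  have e3 : k * (2 * m + 1) = 2 * (k * m) + k := by ring
  have e4 : k * (2 * m + 1 + 1) = 2 * (k * m) + 2 * k := by ring
  refine isRadoNumber_radoEquation (by omega) (fun c h1 => ?_) ⟨_, solutionFree_three_intervals
    (a := 4 * m + 2) (M := M) hk6 (by omega) (by omega)
    (by omega) (by omega) (by omega) (fun _ => ⟨3 * m + 1, by omega, by omega⟩)
    (fun _ => ⟨2 * m + 1, by omega, by omega⟩)⟩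
  by_cases hm4 : 4 ≤ m
  · exact not_solutionFree_three_to_six hm4 hk hd hdf he hy hy' ht hM hN h1
  have hm' : m = 0 ∨ m = 1 ∨ m = 2 ∨ m = 3 := by omega
  have hd4 : d = 0 ∨ d = 1 ∨ d = 2 ∨ d = 3 := by omega
  obtain rfl | rfl | rfl | rfl := hm'
  · obtain ⟨rfl, rfl⟩ : k = 6 ∧ N = 5 := by omega
    exact not_solutionFree_6 h1
  · obtain rfl | rfl | rfl | rfl := hd4
    · obtain ⟨rfl, rfl⟩ : k = 22 ∧ N = 37 := by omega
      exact not_solutionFree_22 h1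
    · obtain ⟨rfl, rfl⟩ : k = 21 ∧ N = 36 := by omega
      exact not_solutionFree_21 h1
    · obtain ⟨rfl, rfl⟩ : k = 20 ∧ N = 34 := by omega
      exact not_solutionFree_20 h1
    · obtain ⟨rfl, rfl⟩ : k = 19 ∧ N = 32 := by omega
      exact not_solutionFree_19 h1
  · obtain rfl | rfl | rfl | rfl := hd4
    · obtain ⟨rfl, rfl⟩ : k = 38 ∧ N = 102 := by omega
      exact not_solutionFree_38 h1
    · obtain ⟨rfl, rfl⟩ : k = 37 ∧ N = 99 := by omega
      exact not_solutionFree_37 h1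
    · obtain ⟨rfl, rfl⟩ : k = 36 ∧ N = 96 := by omega
      exact not_solutionFree_36 h1
    · obtain ⟨rfl, rfl⟩ : k = 35 ∧ N = 94 := by omega
      exact not_solutionFree_35 h1
  · obtain rfl | rfl | rfl | rfl := hd4
    · obtain ⟨rfl, rfl⟩ : k = 54 ∧ N = 198 := by omega
      exact not_solutionFree_54 h1
    · obtain ⟨rfl, rfl⟩ : k = 53 ∧ N = 195 := by omega
      exact not_solutionFree_53 h1
    · obtain ⟨rfl, rfl⟩ : k = 52 ∧ N = 191 := by omega
      exact not_solutionFree_52 h1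
    · obtain ⟨rfl, rfl⟩ : k = 51 ∧ N = 187 := by omega
      exact not_solutionFree_51 h1

/-- Here a = 5 and M = 22, the value of the general formula, but 22 and 23 can still be red. The gap
test fails at z = 3; a divisibility accident helps: for x, y in {22, 23}, x + y + 45 lies in [89,
91], which contains no multiple of 4. -/
theorem isRadoNumber_fifteen : IsRadoNumber 2 (radoEquation 15) 24 := by
  refine isRadoNumber_radoEquation (by omega) (fun c h1 => not_solutionFree_15 h1)
    ⟨fun n => decide (n < 5 ∨ 22 ≤ n), ?_⟩
  intro x y z w hx hx' hy hy' hz hz' hw hw' e ⟨cx, cy, cz⟩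
  simp only [decide_eq_decide] at cx cy cz
  have : z ≤ 6 := by omega
  interval_cases z <;> omega

/-! ### Assembly of all residue classes -/

theorem mainTheorem1 (k : ℕ) (hk : 6 ≤ k) (hk16 : k ≠ 16) :
    ∃ N : ℕ, IsRadoNumber 2 (radoEquation k) N ∧
      (k = 15 → N = 24) ∧
      (k % 16 = 0 → (N : ℚ) = ((k : ℚ) ^ 2 + 6 * k + 16) / 16) ∧
      (k % 16 = 1 ∨ k % 16 = 10 → (N : ℚ) = ((k : ℚ) ^ 2 + 5 * k + 10) / 16) ∧
      (k % 16 = 2 → (N : ℚ) = ((k : ℚ) ^ 2 + 4 * k + 4) / 16) ∧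
      (k % 16 = 7 → (N : ℚ) = ((k : ℚ) ^ 2 + 8 * k + 7) / 16) ∧
      (k % 16 = 8 → (N : ℚ) = ((k : ℚ) ^ 2 + 7 * k + 8) / 16) ∧
      (k % 16 = 9 → (N : ℚ) = ((k : ℚ) ^ 2 + 6 * k + 9) / 16) ∧
      (k % 16 = 11 → (N : ℚ) = ((k : ℚ) ^ 2 + 9 * k + 20) / 16) ∧
      (k % 16 = 12 → (N : ℚ) = ((k : ℚ) ^ 2 + 8 * k + 16) / 16) ∧
      (k % 16 = 13 → (N : ℚ) = ((k : ℚ) ^ 2 + 7 * k + 12) / 16) ∧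
      (k % 16 = 14 → (N : ℚ) = ((k : ℚ) ^ 2 + 6 * k + 8) / 16) ∧
      (k % 16 = 15 → k ≠ 15 → (N : ℚ) = ((k : ℚ) ^ 2 + 7 * k + 22) / 16) ∧
      (k % 64 = 3 ∨ k % 64 = 35 → (N : ℚ) = (4 * (k : ℚ) ^ 2 + 30 * k + 66) / 64) ∧
      (k % 64 = 19 ∨ k % 64 = 51 → (N : ℚ) = (4 * (k : ℚ) ^ 2 + 30 * k + 34) / 64) ∧
      (k % 64 = 4 ∨ k % 64 = 36 → (N : ℚ) = (4 * (k : ℚ) ^ 2 + 26 * k + 24) / 64) ∧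
      (k % 64 = 20 ∨ k % 64 = 52 → (N : ℚ) = (4 * (k : ℚ) ^ 2 + 26 * k + 56) / 64) ∧
      (k % 64 = 5 ∨ k % 64 = 37 → (N : ℚ) = (4 * (k : ℚ) ^ 2 + 22 * k + 46) / 64) ∧
      (k % 64 = 21 ∨ k % 64 = 53 → (N : ℚ) = (4 * (k : ℚ) ^ 2 + 22 * k + 78) / 64) ∧
      (k % 64 = 6 ∨ k % 64 = 38 → (N : ℚ) = (4 * (k : ℚ) ^ 2 + 18 * k + 68) / 64) ∧
      (k % 64 = 22 ∨ k % 64 = 54 → (N : ℚ) = (4 * (k : ℚ) ^ 2 + 18 * k + 36) / 64) := by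
  obtain ⟨m, r, hr, hkm⟩ : ∃ m r, r < 16 ∧ k = 16 * m + r :=
    ⟨k / 16, k % 16, Nat.mod_lt _ (by norm_num), (Nat.div_add_mod k 16).symm⟩
  have hq : (k : ℚ) = 16 * m + r := by rw [hkm]; push_cast; ring
  interval_cases r
  on_goal 16 =>
    obtain rfl | hm0 := Nat.eq_zero_or_pos m
    on_goal 2 => refine ⟨k * (m + 1) + 6 * (m + 1) + 1, isRadoNumber_fifteen_to_two (m := m + 1)
        (d := 3)
        (by omega) (by omega) (by omega) (by omega) hk16 rfl, ?_⟩
    on_goal 1 =>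
      obtain rfl : k = 15 := by omega
      refine ⟨24, isRadoNumber_fifteen, ?_⟩
  on_goal 15 => refine ⟨k * (m + 1) + 4 * (m + 1), isRadoNumber_eleven_to_fourteen (m := m + 1)
      (d := 2)
      (by omega) (by omega) (by omega) (by omega) rfl, ?_⟩
  on_goal 14 => refine ⟨k * (m + 1) + 4 * (m + 1), isRadoNumber_eleven_to_fourteen (m := m + 1)
      (d := 3)
      (by omega) (by omega) (by omega) (by omega) rfl, ?_⟩
  on_goal 13 => refine ⟨k * (m + 1) + 4 * (m + 1), isRadoNumber_eleven_to_fourteen (m := m + 1)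
      (d := 4)
      (by omega) (by omega) (by omega) (by omega) rfl, ?_⟩
  on_goal 12 => refine ⟨k * (m + 1) + 4 * (m + 1), isRadoNumber_eleven_to_fourteen (m := m + 1)
      (d := 5)
      (by omega) (by omega) (by omega) (by omega) rfl, ?_⟩
  on_goal 11 => refine ⟨k * m + 15 * m + 10, isRadoNumber_seven_to_ten (m := m) (d := 0)
      (by omega) (by omega) (by omega), ?_⟩
  on_goal 10 => refine ⟨k * m + 15 * m + 9, isRadoNumber_seven_to_ten (m := m) (d := 1)
      (by omega) (by omega) (by omega), ?_⟩
  on_goal 9 => refine ⟨k * m + 15 * m + 8, isRadoNumber_seven_to_ten (m := m) (d := 2) (by omega)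
      (by omega) (by omega), ?_⟩
  on_goal 8 => refine ⟨k * m + 15 * m + 7, isRadoNumber_seven_to_ten (m := m) (d := 3) (by omega)
      (by omega) (by omega), ?_⟩
  on_goal 7 =>
    -- In the classes 3 to 6, t and y ∈ [1, 4] are determined by y + 2m + 3f = 4t + 2d, hence depend
    -- on the parity of m; this is the source of the finer moduli.
    obtain ⟨n, rfl | rfl⟩ := Nat.even_or_odd' m
    on_goal 2 => refine ⟨k * (2 * n + 1) + 10 * (2 * n + 1) + 4 + (n + 1), isRadoNumber_three_to_six
        (d := 0) (f := 0) (e := 0) (y := 2)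
        (t := n + 1) hk (by omega) (by omega) (by omega) (by omega) (by omega) (by omega) (by omega)
        rfl rfl, ?_⟩
    on_goal 1 => refine ⟨k * (2 * n) + 10 * (2 * n) + 4 + (n + 1), isRadoNumber_three_to_six
        (d := 0)
        (f := 0) (e := 0) (y := 4)
        (t := n + 1) hk (by omega) (by omega) (by omega) (by omega) (by omega) (by omega) (by omega)
        rfl rfl, ?_⟩
  on_goal 6 =>
    obtain ⟨n, rfl | rfl⟩ := Nat.even_or_odd' m
    on_goal 2 => refine ⟨k * (2 * n + 1) + 10 * (2 * n + 1) + 4 + (n + 1), isRadoNumber_three_to_six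
        (d := 1) (f := 0) (e := 1) (y := 4)
        (t := n + 1) hk (by omega) (by omega) (by omega) (by omega) (by omega) (by omega) (by omega)
        rfl rfl, ?_⟩
    on_goal 1 => refine ⟨k * (2 * n) + 10 * (2 * n) + 4 + n, isRadoNumber_three_to_six (d := 1)
        (f := 0)
        (e := 1) (y := 2)
        (t := n) hk (by omega) (by omega) (by omega) (by omega) (by omega) (by omega) (by omega)
        rfl rfl, ?_⟩
  on_goal 5 =>
    obtain ⟨n, rfl | rfl⟩ := Nat.even_or_odd' m
    on_goal 2 => refine ⟨k * (2 * n + 1) + 10 * (2 * n + 1) + 3 + (n + 1), isRadoNumber_three_to_six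
        (d := 2) (f := 1) (e := 0) (y := 3)
        (t := n + 1) hk (by omega) (by omega) (by omega) (by omega) (by omega) (by omega) (by omega)
        rfl rfl, ?_⟩
    on_goal 1 => refine ⟨k * (2 * n) + 10 * (2 * n) + 3 + n, isRadoNumber_three_to_six (d := 2)
        (f := 1)
        (e := 0) (y := 1)
        (t := n) hk (by omega) (by omega) (by omega) (by omega) (by omega) (by omega) (by omega)
        rfl rfl, ?_⟩
  on_goal 4 =>
    obtain ⟨n, rfl | rfl⟩ := Nat.even_or_odd' m
    on_goal 2 => refine ⟨k * (2 * n + 1) + 10 * (2 * n + 1) + 3 + n, isRadoNumber_three_to_six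
        (d := 3)
        (f := 1) (e := 1) (y := 1)
        (t := n) hk (by omega) (by omega) (by omega) (by omega) (by omega) (by omega) (by omega)
        rfl rfl, ?_⟩
    on_goal 1 => refine ⟨k * (2 * n) + 10 * (2 * n) + 3 + n, isRadoNumber_three_to_six (d := 3)
        (f := 1)
        (e := 1) (y := 3)
        (t := n) hk (by omega) (by omega) (by omega) (by omega) (by omega) (by omega) (by omega)
        rfl rfl, ?_⟩
  on_goal 3 => refine ⟨k * m + 6 * m + 1, isRadoNumber_fifteen_to_two (m := m) (d := 0)
      (by omega) (by omega) (by omega) (by omega) hk16 rfl, ?_⟩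
  on_goal 2 => refine ⟨k * m + 6 * m + 1, isRadoNumber_fifteen_to_two (m := m) (d := 1)
      (by omega) (by omega) (by omega) (by omega) hk16 rfl, ?_⟩
  on_goal 1 => refine ⟨k * m + 6 * m + 1, isRadoNumber_fifteen_to_two (m := m) (d := 2)
      (by omega) (by omega) (by omega) (by omega) hk16 rfl, ?_⟩
  all_goals
    refine ⟨?_, ?_, ?_, ?_, ?_, ?_, ?_, ?_, ?_, ?_, ?_, ?_, ?_, ?_, ?_, ?_, ?_, ?_, ?_, ?_⟩ <;>
      intros <;> first | omega | (push_cast [hq]; ring)
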